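/- **Conventions.** For a function $f$ of one complex variable put $\{f,z\}=\dfrac{2f'(z)f'''(z)-3f''(z)^2}{2f'(z)^2}$ (the Schwarzian derivative). A *modular group* is a subgroup $\Gamma\subset SL_2(\mathbb R)$ commensurable with $SL_2(\mathbb Z)$. A *modular function* for $\Gamma$ is a $\Gamma$-invariant meromorphic function on the upper half plane $\mathbb H$ that is meromorphic at the cusps of $\Gamma$. The group $\Gamma$ has genus zero, with *hauptmodul* $h$, if $h$ is a nonconstant modular function for $\Gamma$ such that every modular function for $\Gamma$ is a rational function of $h$ with complex coefficients. **Theorem.** Let $\Gamma$ and $\Gamma'$ be genus-zero modular groups with hauptmoduls $h$ and $t$ respectively. Let $n\ge 1$ be an integer, and suppose that there are rational functions $h_1,h_2\in\mathbb C(X)$ with $h(\tau)=h_1(t(\tau))$ and $h(n\tau)=h_2(t(\tau))$ as meromorphic functions on $\mathbb H$. Then there are a unique rational function $Q_\Gamma$ and a unique rational function $Q_{\Gamma'}$ (which depend on the chosen hauptmoduls $h$ and $t$) with $$h'(\tau)^2\,Q_\Gamma(h(\tau))+\tfrac12\{h(\tau),\tau\}=0,\qquad t'(\tau)^2\,Q_{\Gamma'}(t(\tau))+\tfrac12\{t(\tau),\tau\}=0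 ,$$ and, as rational functions of the variable $t$, $$h_1'(t)^2\,Q_\Gamma(h_1(t))+\tfrac12\{h_1(t),t\}=h_2'(t)^2\,Q_\Gamma(h_2(t))+\tfrac12\{h_2(t),t\}=Q_{\Gamma'}(t).$$ -/

import Mathlib

open UpperHalfPlane Filter OnePoint
open scoped MatrixGroups

noncomputable section

/-- The value at `z` of a rational function `R` with complex coefficients. -/
def RatFunc.value (R : RatFunc ℂ) (z : ℂ) : ℂ :=
  R.eval (RingHom.id ℂ) z

/-- The Schwarzian derivative `{f, z} = (2 f' f''' - 3 f''²) / (2 f'²)`. -/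
def schwarzian (f : ℂ → ℂ) (z : ℂ) : ℂ :=
  (2 * deriv f z * iteratedDeriv 3 f z - 3 * iteratedDeriv 2 f z ^ 2) / (2 * deriv f z ^ 2)

/-- The expression `f'(z)² Q(f(z)) + ½ {f, z}`. -/
def schwarzianBox (Q : RatFunc ℂ) (f : ℂ → ℂ) (z : ℂ) : ℂ :=
  deriv f z ^ 2 * Q.value (f z) + 1 / 2 * schwarzian f z

/-- A modular function for `Γ`. Meromorphic functions on `ℍ` are represented by functions
`ℍ → ℂ` whose values at the points of a closed discrete set (such as the poles) are irrelevant, so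
that identities between them are required off a closed discrete subset of `ℍ` only (the
filter `codiscrete ℍ`). -/
structure IsModularFunction (Γ : Subgroup (GL (Fin 2) ℝ)) (f : ℍ → ℂ) : Prop where
  /-- `f` is meromorphic on the upper half plane. -/
  meromorphic : ∀ τ : ℍ, MeromorphicAt (f ∘ ofComplex) (τ : ℂ)
  /-- `f` is invariant under `Γ`. -/
  invariant : ∀ γ ∈ Γ, ∀ᶠ τ in codiscrete ℍ, f (γ • τ) = f τ
  /-- `f` is meromorphic at every cusp `g ∞` of `Γ`: for some `w > 0`, the function `f (g τ)` is,
  for large `Im τ`, a meromorphic function of the local parameter `exp (2 π i τ / w)`. -/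
  meromorphic_cusp : ∀ g : SL(2, ℝ), IsCusp ((g : GL (Fin 2) ℝ) • (∞ : OnePoint ℝ)) Γ →
    ∃ w : ℝ, 0 < w ∧ ∃ F : ℂ → ℂ, MeromorphicAt F 0 ∧
      ∀ᶠ τ in atImInfty ⊓ codiscrete ℍ, f (g • τ) = F (Function.Periodic.qParam w (τ : ℂ))

/-- `h` is a hauptmodul for `Γ`: a nonconstant modular function for `Γ` that generates the field
of all modular functions for `Γ` over `ℂ`. For an arithmetic group `Γ`, such an `h` exists if and
only if the compactified quotient of `ℍ` by `Γ` has genus zero. -/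
structure IsHauptmodul (Γ : Subgroup (GL (Fin 2) ℝ)) (h : ℍ → ℂ) : Prop where
  isModularFunction : IsModularFunction Γ h
  nonconstant : ¬ ∃ c : ℂ, ∀ᶠ τ in codiscrete ℍ, h τ = c
  generates : ∀ f : ℍ → ℂ, IsModularFunction Γ f →
    ∃ R : RatFunc ℂ, ∀ᶠ τ in codiscrete ℍ, f τ = R.value (h τ)

/-- `Q` is a `Q`-value for `h`: the Schwarzian differential equation
`h'(τ)² Q(h(τ)) + ½ {h, τ} = 0` holds as an identity of meromorphic functions on `ℍ`. -/
def IsQValue (h : ℍ → ℂ) (Q : RatFunc ℂ) : Prop :=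
  ∀ᶠ τ : ℍ in codiscrete ℍ, schwarzianBox Q (h ∘ ofComplex) (τ : ℂ) = 0

end

/-!
A Möbius transformation has zero Schwarzian derivative, so by the chain rule
`{f ∘ φ, z} = φ'(z)² {f, φ(z)} + {φ, z}` the quotient `-{h, τ} / (2 h'(τ)²)` is again invariant under
`Γ`. At a cusp `h` is a meromorphic function `F` of `q = exp (2 π i τ / w)`, with `{q, τ}` a constant
and `dq/dτ` a constant multiple of `q`, so the quotient is a meromorphic function of `q` as well. It is
therefore a modular function (`IsModularFunction.schwarzianQuotient`), and a rational function `Q` of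
the hauptmodul `h`: this is the `Q`-value of `h`. It is unique, because a nonconstant meromorphic
function on `ℍ` avoids any given finite set of values off a closed discrete set
(`tendsto_cofinite_of_nonconstant`).

Now let `f = r ∘ t`, where `f` satisfies the Schwarzian equation of `Q`. The chain rule turns this
equation into `t'(τ)² (r'(t)² Q(r(t)) + ½ {r, t}) + ½ {t, τ} = 0`, and comparison with the equation of
`t` gives `r'(t)² Q(r(t)) + ½ {r, t} = Q'(t)` at `t = t(τ)`, hence as rational functions
(`eventually_schwarzianBox_eq_value`). This applies to `f = h` and to `f(τ) = h(nτ)`: the latter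
satisfies the equation of `Q` too, since `τ ↦ nτ` is a Möbius transformation (`IsQValue.comp_smul`).
-/

open scoped Topology Polynomial

/-! ### The Schwarzian derivative and its chain rule -/

theorem schwarzian_congr {f g : ℂ → ℂ} {z : ℂ} (hfg : f =ᶠ[𝓝 z] g) :
    schwarzian f z = schwarzian g z := by
  simp only [schwarzian, hfg.deriv_eq, hfg.iteratedDeriv_eq]

theorem schwarzianBox_congr (Q : RatFunc ℂ) {f g : ℂ → ℂ} {z : ℂ} (hfg : f =ᶠ[𝓝 z] g) :
    schwarzianBox Q f z = schwarzianBox Q g z := by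
  simp only [schwarzianBox, hfg.deriv_eq, hfg.eq_of_nhds, schwarzian_congr hfg]

/-- Reads off the three derivatives entering the Schwarzian from explicit formulas for them. -/
theorem iteratedDeriv_eq_of_hasDerivAt {f f₁ f₂ : ℂ → ℂ} {f₃ z : ℂ}
    (h₁ : ∀ᶠ w in 𝓝 z, HasDerivAt f (f₁ w) w) (h₂ : ∀ᶠ w in 𝓝 z, HasDerivAt f₁ (f₂ w) w)
    (h₃ : HasDerivAt f₂ f₃ z) :
    deriv f z = f₁ z ∧ iteratedDeriv 2 f z = f₂ z ∧ iteratedDeriv 3 f z = f₃ := by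
  have e₁ : deriv f =ᶠ[𝓝 z] f₁ := h₁.mono fun w hw ↦ hw.deriv
  have e₂ : deriv (deriv f) =ᶠ[𝓝 z] f₂ := e₁.deriv.trans (h₂.mono fun w hw ↦ hw.deriv)
  refine ⟨e₁.eq_of_nhds, ?_, ?_⟩
  · simpa [iteratedDeriv_succ, iteratedDeriv_zero] using e₂.eq_of_nhds
  · simpa [iteratedDeriv_succ, iteratedDeriv_zero] using e₂.deriv_eq.trans h₃.deriv

theorem schwarzian_comp {f φ : ℂ → ℂ} {z : ℂ} (hf : AnalyticAt ℂ f (φ z)) (hφ : AnalyticAt ℂ φ z)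
    (hf' : deriv f (φ z) ≠ 0) (hφ' : deriv φ z ≠ 0) :
    schwarzian (f ∘ φ) z = deriv φ z ^ 2 * schwarzian f (φ z) + schwarzian φ z := by
  have key : ∀ {g : ℂ → ℂ} {w : ℂ}, AnalyticAt ℂ g w → ∀ᶠ u in 𝓝 w, HasDerivAt g (deriv g u) u :=
    fun hg ↦ hg.eventually_analyticAt.mono fun u hu ↦ hu.differentiableAt.hasDerivAt
  have cf := fun {p : ℂ → Prop} (hp : ∀ᶠ u in 𝓝 (φ z), p u) ↦ hφ.continuousAt.eventually hp
  obtain ⟨e₁, e₂, e₃⟩ := iteratedDeriv_eq_of_hasDerivAt (f := f ∘ φ) (z := z)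
    (f₁ := fun w ↦ deriv f (φ w) * deriv φ w)
    (f₂ := fun w ↦ deriv (deriv f) (φ w) * deriv φ w * deriv φ w
      + deriv f (φ w) * deriv (deriv φ) w)
    (f₃ := (deriv (deriv (deriv f)) (φ z) * deriv φ z * deriv φ z
        + deriv (deriv f) (φ z) * deriv (deriv φ) z) * deriv φ z
      + deriv (deriv f) (φ z) * deriv φ z * deriv (deriv φ) z
      + (deriv (deriv f) (φ z) * deriv φ z * deriv (deriv φ) z
        + deriv f (φ z) * deriv (deriv (deriv φ)) z))
    (by filter_upwards [cf (key hf), key hφ] with w h₁ h₂ using h₁.comp w h₂)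
    (by filter_upwards [cf (key hf.deriv), key hφ, key hφ.deriv] with w h₁ h₂ h₃
          using (h₁.comp w h₂).mul h₃)
    ((((key hf.deriv.deriv).self_of_nhds.comp z (key hφ).self_of_nhds).mul
        (key hφ.deriv).self_of_nhds |>.mul (key hφ.deriv).self_of_nhds).add
      (((key hf.deriv).self_of_nhds.comp z (key hφ).self_of_nhds).mul
        (key hφ.deriv.deriv).self_of_nhds))
  simp only [schwarzian, e₁, e₂, e₃]
  simp only [iteratedDeriv_succ, iteratedDeriv_zero]
  field_simp
  ring

theorem deriv_comp_of_analyticAt {f φ : ℂ → ℂ} {z : ℂ} (hf : AnalyticAt ℂ f (φ z))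
    (hφ : AnalyticAt ℂ φ z) : deriv (f ∘ φ) z = deriv f (φ z) * deriv φ z :=
  deriv_comp z hf.differentiableAt hφ.differentiableAt

theorem schwarzianBox_comp (Q : RatFunc ℂ) {f φ : ℂ → ℂ} {z : ℂ} (hf : AnalyticAt ℂ f (φ z))
    (hφ : AnalyticAt ℂ φ z) (hf' : deriv f (φ z) ≠ 0) (hφ' : deriv φ z ≠ 0) :
    schwarzianBox Q (f ∘ φ) z =
      deriv φ z ^ 2 * schwarzianBox Q f (φ z) + 1 / 2 * schwarzian φ z := by
  simp only [schwarzianBox, schwarzian_comp hf hφ hf' hφ', deriv_comp_of_analyticAt hf hφ,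
    Function.comp_apply]
  ring

/-- Möbius transformations have zero Schwarzian derivative. -/
theorem schwarzian_smul {g : GL (Fin 2) ℝ} (hg : 0 < g.val.det) (τ : ℍ) :
    schwarzian (fun z ↦ ↑(g • ofComplex z)) τ = 0 := by
  have nhds : ∀ {p : ℂ → Prop}, (∀ σ : ℍ, p σ) → ∀ᶠ w in 𝓝 (τ : ℂ), p w := fun hp ↦ by
    filter_upwards [isOpen_upperHalfPlaneSet.mem_nhds τ.im_pos] with w hw using hp ⟨w, hw⟩
  obtain ⟨e₁, e₂, e₃⟩ := iteratedDeriv_eq_of_hasDerivAt (z := (τ : ℂ))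
    (f := fun z ↦ ↑(g • ofComplex z))
    (nhds fun σ ↦ by
      simpa [div_eq_mul_inv, zpow_neg] using! (hasStrictDerivAt_smul hg σ).hasDerivAt)
    (nhds fun σ ↦ (hasDerivAt_denom_zpow g (-2) σ).const_mul (g.val.det : ℂ))
    (((hasDerivAt_denom_zpow g (-3) τ).const_mul (((-2 : ℤ) : ℂ) * g 1 0)).const_mul
      (g.val.det : ℂ))
  have hd := denom_ne_zero g τ
  rw [schwarzian, e₁, e₂, e₃, div_eq_zero_iff]
  left
  norm_num [zpow_neg]
  field_simp
  ring

theorem qParam_hasDerivAt (w : ℝ) (z : ℂ) :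
    HasDerivAt (Function.Periodic.qParam w)
      (2 * Real.pi * Complex.I / w * Function.Periodic.qParam w z) z := by
  have := (((hasDerivAt_id z).const_mul (2 * Real.pi * Complex.I)).div_const (w : ℂ)).cexp
  rw [mul_comm]
  simpa [Function.Periodic.qParam] using! this

theorem schwarzian_qParam {w : ℝ} (hw : w ≠ 0) (z : ℂ) :
    schwarzian (Function.Periodic.qParam w) z = -(2 * Real.pi * Complex.I / w) ^ 2 / 2 := by
  set c : ℂ := 2 * Real.pi * Complex.I / w with hc
  have hc0 : c ≠ 0 := div_ne_zero Complex.two_pi_I_ne_zero (mod_cast hw)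
  obtain ⟨e₁, e₂, e₃⟩ := iteratedDeriv_eq_of_hasDerivAt (z := z)
    (.of_forall fun u ↦ qParam_hasDerivAt w u)
    (.of_forall fun u ↦ (qParam_hasDerivAt w u).const_mul c)
    (((qParam_hasDerivAt w z).const_mul c).const_mul c)
  have hq := Function.Periodic.qParam_ne_zero (h := w) z
  rw [schwarzian, e₁, e₂, e₃, ← hc]
  field_simp
  ring

/-! ### Functions that agree with a rational function off a finite set -/

/-- The functions `ℂ → ℂ` that agree with a quotient of two polynomials off a finite set. -/
def IsCofinitelyRational (f : ℂ → ℂ) : Prop :=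
  ∃ p q : ℂ[X], q ≠ 0 ∧ ∀ᶠ z in cofinite, f z = p.eval z / q.eval z

theorem Polynomial.eventually_cofinite_eval_ne_zero {p : ℂ[X]} (hp : p ≠ 0) :
    ∀ᶠ z in cofinite, p.eval z ≠ 0 := by
  have : {z | p.IsRoot z}.Finite := Polynomial.finite_setOfPred_isRoot hp
  simpa [Filter.Eventually, mem_cofinite, Set.compl_ofPred] using! this

theorem eventually_cofinite_eventually_nhds {p : ℂ → Prop} (hp : ∀ᶠ z in cofinite, p z) :
    ∀ᶠ z in cofinite, ∀ᶠ w in 𝓝 z, p w := by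
  have ho : IsOpen {z | p z} := by
    rw [← isClosed_compl_iff]; exact Set.Finite.isClosed hp
  exact hp.mono fun z hz ↦ ho.mem_nhds hz

namespace IsCofinitelyRational

variable {f g : ℂ → ℂ}

theorem eval (p : ℂ[X]) : IsCofinitelyRational fun z ↦ p.eval z :=
  ⟨p, 1, one_ne_zero, by simp⟩

theorem const (c : ℂ) : IsCofinitelyRational fun _ ↦ c := by simpa using eval (Polynomial.C c)

theorem add (hf : IsCofinitelyRational f) (hg : IsCofinitelyRational g) :
    IsCofinitelyRational fun z ↦ f z + g z := by
  obtain ⟨p, q, hq, h⟩ := hf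
  obtain ⟨p', q', hq', h'⟩ := hg
  refine ⟨p * q' + q * p', q * q', mul_ne_zero hq hq', ?_⟩
  filter_upwards [h, h', Polynomial.eventually_cofinite_eval_ne_zero hq,
    Polynomial.eventually_cofinite_eval_ne_zero hq'] with z h₁ h₂ h₃ h₄
  simp only [h₁, h₂, Polynomial.eval_add, Polynomial.eval_mul, div_add_div _ _ h₃ h₄]

theorem mul (hf : IsCofinitelyRational f) (hg : IsCofinitelyRational g) :
    IsCofinitelyRational fun z ↦ f z * g z := by
  obtain ⟨p, q, hq, h⟩ := hf
  obtain ⟨p', q', hq', h'⟩ := hg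
  refine ⟨p * p', q * q', mul_ne_zero hq hq', ?_⟩
  filter_upwards [h, h'] with z h₁ h₂
  simp only [h₁, h₂, Polynomial.eval_mul, div_mul_div_comm]

/-- Inverting keeps the class, also for a function that vanishes off a finite set, as `0⁻¹ = 0`. -/
theorem inv (hf : IsCofinitelyRational f) : IsCofinitelyRational fun z ↦ (f z)⁻¹ := by
  obtain ⟨p, q, hq, h⟩ := hf
  rcases eq_or_ne p 0 with rfl | hp
  · exact ⟨0, 1, one_ne_zero, h.mono fun z hz ↦ by simp [hz]⟩
  · exact ⟨q, p, hp, h.mono fun z hz ↦ by simp [hz]⟩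

theorem div (hf : IsCofinitelyRational f) (hg : IsCofinitelyRational g) :
    IsCofinitelyRational fun z ↦ f z / g z := by
  simpa only [div_eq_mul_inv] using hf.mul hg.inv

theorem sub (hf : IsCofinitelyRational f) (hg : IsCofinitelyRational g) :
    IsCofinitelyRational fun z ↦ f z - g z := by
  simpa [sub_eq_add_neg] using hf.add ((const (-1)).mul hg)

theorem pow (hf : IsCofinitelyRational f) (n : ℕ) : IsCofinitelyRational fun z ↦ f z ^ n := by
  induction n with
  | zero => simpa using const 1
  | succ n ih => simpa only [pow_succ] using ih.mul hf

theorem polynomial_comp (P : ℂ[X]) (hf : IsCofinitelyRational f) :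
    IsCofinitelyRational fun z ↦ P.eval (f z) := by
  induction P using Polynomial.induction_on' with
  | add p q hp hq => simpa using hp.add hq
  | monomial n a => simpa using (const a).mul (hf.pow n)

theorem value_comp (R : RatFunc ℂ) (hf : IsCofinitelyRational f) :
    IsCofinitelyRational fun z ↦ R.value (f z) :=
  (polynomial_comp R.num hf).div (polynomial_comp R.denom hf)

theorem value (R : RatFunc ℂ) : IsCofinitelyRational R.value := by
  simpa using value_comp R (eval Polynomial.X)

theorem deriv (hf : IsCofinitelyRational f) : IsCofinitelyRational (deriv f) := by
  obtain ⟨p, q, hq, h⟩ := hf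
  refine ⟨p.derivative * q - p * q.derivative, q ^ 2, pow_ne_zero 2 hq, ?_⟩
  filter_upwards [eventually_cofinite_eventually_nhds h,
    Polynomial.eventually_cofinite_eval_ne_zero hq] with z h₁ h₂
  have h₁ : f =ᶠ[𝓝 z] fun w ↦ p.eval w / q.eval w := h₁
  rw [h₁.deriv_eq]
  simpa using! ((p.hasDerivAt z).div (q.hasDerivAt z) h₂).deriv

theorem iteratedDeriv (hf : IsCofinitelyRational f) (n : ℕ) :
    IsCofinitelyRational (iteratedDeriv n f) := by
  induction n with
  | zero => simpa using hf
  | succ n ih => simpa only [iteratedDeriv_succ] using ih.deriv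

theorem schwarzianBox (Q : RatFunc ℂ) (hf : IsCofinitelyRational f) :
    IsCofinitelyRational (schwarzianBox Q f) := by
  have h₁ := hf.deriv
  have h₂ := hf.iteratedDeriv 2
  have h₃ := hf.iteratedDeriv 3
  exact ((h₁.pow 2).mul (value_comp Q hf)).add ((const (1 / 2)).mul
    (((((const 2).mul h₁).mul h₃).sub ((const 3).mul (h₂.pow 2))).div ((const 2).mul (h₁.pow 2))))

theorem eventually_eq_zero_or_ne_zero (hf : IsCofinitelyRational f) :
    (∀ᶠ z in cofinite, f z = 0) ∨ ∀ᶠ z in cofinite, f z ≠ 0 := by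
  obtain ⟨p, q, hq, h⟩ := hf
  rcases eq_or_ne p 0 with rfl | hp
  · exact .inl (h.mono fun z hz ↦ by simp [hz])
  · right
    filter_upwards [h, Polynomial.eventually_cofinite_eval_ne_zero hp,
      Polynomial.eventually_cofinite_eval_ne_zero hq] with z h₁ h₂ h₃
    rw [h₁]; exact div_ne_zero h₂ h₃

end IsCofinitelyRational

theorem RatFunc.analyticAt_value (R : RatFunc ℂ) :
    ∀ᶠ z in cofinite, AnalyticAt ℂ R.value z := by
  filter_upwards [Polynomial.eventually_cofinite_eval_ne_zero R.denom_ne_zero] with z hz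
  exact (R.num.differentiable.analyticAt z).div (R.denom.differentiable.analyticAt z) hz

theorem RatFunc.eq_of_eventually_value_eq {R S : RatFunc ℂ}
    (h : ∀ᶠ z in cofinite, R.value z = S.value z) : R = S := by
  rw [← R.num_div_denom, ← S.num_div_denom, div_eq_div_iff
    (by simpa using R.denom_ne_zero) (by simpa using S.denom_ne_zero), ← map_mul, ← map_mul]
  congr 1
  by_contra hne
  obtain ⟨z, h₁, h₂, h₃, h₄⟩ := (h.and <|
    (Polynomial.eventually_cofinite_eval_ne_zero R.denom_ne_zero).and <|
    (Polynomial.eventually_cofinite_eval_ne_zero S.denom_ne_zero).and <|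
      Polynomial.eventually_cofinite_eval_ne_zero (sub_ne_zero.mpr hne)).exists
  refine h₄ ?_
  rw [Polynomial.eval_sub, Polynomial.eval_mul, Polynomial.eval_mul, sub_eq_zero]
  exact (div_eq_div_iff h₂ h₃).mp h₁

/-! ### Codiscrete sets in the upper half plane -/

theorem eventually_codiscrete_iff {X : Type*} [TopologicalSpace X] {p : X → Prop} :
    (∀ᶠ x in codiscrete X, p x) ↔ ∀ x, ∀ᶠ y in 𝓝[≠] x, p y := by
  simpa [codiscrete] using! mem_codiscreteWithin_iff_forall_mem_nhdsNE (S := {x | p x})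
    (T := Set.univ)

/-- Codiscrete sets are open, so an identity off a closed discrete set may be differentiated. -/
theorem Filter.Eventually.eventually_nhds_codiscrete {X : Type*} [TopologicalSpace X]
    {p : X → Prop} (hp : ∀ᶠ x in codiscrete X, p x) :
    ∀ᶠ x in codiscrete X, ∀ᶠ y in 𝓝 x, p y := by
  filter_upwards [hp] with x hx
  rw [← nhdsNE_sup_pure, eventually_sup]
  exact ⟨eventually_codiscrete_iff.mp hp x, hx⟩

theorem tendsto_codiscrete_of_injective {X Y : Type*} [TopologicalSpace X] [TopologicalSpace Y]
    {f : X → Y} (hf : Continuous f) (hinj : Function.Injective f) :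
    Tendsto f (codiscrete X) (codiscrete Y) := by
  intro s hs
  refine eventually_codiscrete_iff.mpr fun x ↦ ?_
  have : Tendsto f (𝓝[≠] x) (𝓝[≠] (f x)) :=
    tendsto_nhdsWithin_of_tendsto_nhds_of_eventually_within _
      (hf.continuousAt.mono_left nhdsWithin_le_nhds)
      (eventually_nhdsWithin_of_forall fun y hy ↦ hinj.ne hy)
  exact this.eventually (eventually_codiscrete_iff.mp hs (f x))

instance neBot_codiscrete_upperHalfPlane : (codiscrete ℍ).NeBot := by
  refine ⟨fun h ↦ ?_⟩
  have : ∀ᶠ _ in codiscrete ℍ, False := by simp [h]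
  exact (eventually_codiscrete_iff.mp this I).exists.choose_spec

theorem tendsto_smul_codiscrete (g : GL (Fin 2) ℝ) :
    Tendsto (fun τ : ℍ ↦ g • τ) (codiscrete ℍ) (codiscrete ℍ) :=
  tendsto_codiscrete_of_injective (continuous_const_smul g) (MulAction.injective g)

theorem eventually_codiscrete_of_nhdsNE {p : ℂ → Prop}
    (hp : ∀ τ : ℍ, ∀ᶠ z in 𝓝[≠] (τ : ℂ), p z) : ∀ᶠ τ : ℍ in codiscrete ℍ, p τ := by
  refine eventually_codiscrete_iff.mpr fun τ ↦ ?_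
  have : Tendsto ((↑) : ℍ → ℂ) (𝓝[≠] τ) (𝓝[≠] (τ : ℂ)) :=
    tendsto_nhdsWithin_of_tendsto_nhds_of_eventually_within _
      (continuous_coe.continuousAt.mono_left nhdsWithin_le_nhds)
      (eventually_nhdsWithin_of_forall fun y hy ↦ UpperHalfPlane.ext_iff.not.mp hy)
  exact this.eventually (hp τ)

theorem eventually_nhds_coe_iff {p : ℂ → Prop} {τ : ℍ} :
    (∀ᶠ z in 𝓝 (τ : ℂ), p z) ↔ ∀ᶠ σ : ℍ in 𝓝 τ, p σ := by
  rw [← isOpenEmbedding_coe.map_nhds_eq, eventually_map]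

theorem comp_ofComplex_eventuallyEq {f g : ℍ → ℂ} {τ : ℍ} (hfg : f =ᶠ[𝓝 τ] g) :
    f ∘ ofComplex =ᶠ[𝓝 (τ : ℂ)] g ∘ ofComplex :=
  eventually_nhds_coe_iff.mpr <| hfg.mono fun σ hσ ↦ by simpa using hσ

theorem comp_smul_comp_ofComplex (h : ℍ → ℂ) (g : GL (Fin 2) ℝ) :
    (fun τ ↦ h (g • τ)) ∘ ofComplex = (h ∘ ofComplex) ∘ fun z ↦ ↑(g • ofComplex z) := by
  ext z; simp

/-! ### Nonconstant meromorphic functions on the upper half plane -/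

/-- The identity principle for meromorphic functions on `ℍ`. -/
theorem eventually_codiscrete_eq_zero_or_ne_zero {f : ℂ → ℂ}
    (hf : ∀ τ : ℍ, MeromorphicAt f τ) :
    (∀ᶠ τ : ℍ in codiscrete ℍ, f τ = 0) ∨ ∀ᶠ τ : ℍ in codiscrete ℍ, f τ ≠ 0 := by
  have hU : IsConnected {z : ℂ | 0 < z.im} :=
    (convex_halfSpace_im_gt 0).isConnected ⟨Complex.I, by simp⟩
  have hf' : MeromorphicOn f {z : ℂ | 0 < z.im} := fun z hz ↦ hf ⟨z, hz⟩
  have key := hf'.exists_meromorphicOrderAt_ne_top_iff_forall hU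
  by_cases h : ∃ u : {z : ℂ | 0 < z.im}, meromorphicOrderAt f u ≠ ⊤
  · exact .inr <| eventually_codiscrete_of_nhdsNE fun τ ↦
      (meromorphicOrderAt_ne_top_iff_eventually_ne_zero (hf τ)).mp (key.mp h ⟨τ, τ.im_pos⟩)
  · push Not at h
    exact .inl <| eventually_codiscrete_of_nhdsNE fun τ ↦
      meromorphicOrderAt_eq_top_iff.mp (h ⟨τ, τ.im_pos⟩)

section Nonconstant

variable {h : ℍ → ℂ}

theorem eventually_analyticAt_of_meromorphicAt (hm : ∀ τ : ℍ, MeromorphicAt (h ∘ ofComplex) τ) :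
    ∀ᶠ τ : ℍ in codiscrete ℍ, AnalyticAt ℂ (h ∘ ofComplex) τ :=
  eventually_codiscrete_of_nhdsNE fun τ ↦ (hm τ).eventually_analyticAt

theorem eventually_ne_of_nonconstant (hm : ∀ τ : ℍ, MeromorphicAt (h ∘ ofComplex) τ)
    (hc : ¬ ∃ c : ℂ, ∀ᶠ τ in codiscrete ℍ, h τ = c) (c : ℂ) :
    ∀ᶠ τ in codiscrete ℍ, h τ ≠ c := by
  rcases eventually_codiscrete_eq_zero_or_ne_zero
    (f := fun z ↦ (h ∘ ofComplex) z - c) (fun τ ↦ (hm τ).sub (.const c _)) with h₀ | h₀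
  · exact (hc ⟨c, h₀.mono fun τ hτ ↦ by simpa [sub_eq_zero] using hτ⟩).elim
  · exact h₀.mono fun τ hτ ↦ by simpa [sub_eq_zero] using hτ

theorem tendsto_cofinite_of_nonconstant (hm : ∀ τ : ℍ, MeromorphicAt (h ∘ ofComplex) τ)
    (hc : ¬ ∃ c : ℂ, ∀ᶠ τ in codiscrete ℍ, h τ = c) :
    Tendsto h (codiscrete ℍ) cofinite := by
  intro s hs
  have hs : sᶜ.Finite := hs
  have := (hs.eventually_all (l := codiscrete ℍ) (p := fun c τ ↦ h τ ≠ c)).mpr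
    fun c _ ↦ eventually_ne_of_nonconstant hm hc c
  refine mem_map.mpr (this.mono fun τ hτ ↦ ?_)
  by_contra hn
  exact hτ _ hn rfl

theorem eventually_deriv_ne_zero_of_nonconstant (hm : ∀ τ : ℍ, MeromorphicAt (h ∘ ofComplex) τ)
    (hc : ¬ ∃ c : ℂ, ∀ᶠ τ in codiscrete ℍ, h τ = c) :
    ∀ᶠ τ : ℍ in codiscrete ℍ, deriv (h ∘ ofComplex) τ ≠ 0 := by
  refine (eventually_codiscrete_eq_zero_or_ne_zero fun τ ↦ (hm τ).deriv).resolve_left fun h₀ ↦ ?_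
  obtain ⟨τ, h₁, h₂⟩ := (h₀.eventually_nhds_codiscrete.and
    (eventually_analyticAt_of_meromorphicAt hm)).exists
  have h₃ : ∀ᶠ z in 𝓝 (τ : ℂ), deriv (h ∘ ofComplex) z = 0 := eventually_nhds_coe_iff.mpr h₁
  obtain ⟨r, hr, hball⟩ := Metric.eventually_nhds_iff_ball.mp (h₃.and h₂.eventually_analyticAt)
  have hconst : ∀ᶠ z in 𝓝 (τ : ℂ), (h ∘ ofComplex) z = h τ := by
    filter_upwards [Metric.ball_mem_nhds _ hr] with z hz
    simpa using Metric.isOpen_ball.is_const_of_deriv_eq_zero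
      (convex_ball _ _).isPreconnected
      (fun w hw ↦ (hball w hw).2.differentiableAt.differentiableWithinAt)
      (fun w hw ↦ (hball w hw).1) hz (Metric.mem_ball_self hr)
  have h₄ := eventually_nhds_coe_iff.mp hconst
  have h₅ := eventually_codiscrete_iff.mp (eventually_ne_of_nonconstant hm hc (h τ)) τ
  obtain ⟨σ, h₆, h₇⟩ := ((eventually_nhdsWithin_of_eventually_nhds h₄).and h₅).exists
  exact h₇ (by simpa using h₆)

/-- A nonconstant meromorphic function satisfies no nontrivial algebraic equation over `ℂ`. -/
theorem IsCofinitelyRational.eventually_eq_of_comp_eq {f g : ℂ → ℂ}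
    (hf : IsCofinitelyRational f) (hg : IsCofinitelyRational g)
    (hm : ∀ τ : ℍ, MeromorphicAt (h ∘ ofComplex) τ)
    (hc : ¬ ∃ c : ℂ, ∀ᶠ τ in codiscrete ℍ, h τ = c)
    (hfg : ∀ᶠ τ in codiscrete ℍ, f (h τ) = g (h τ)) : ∀ᶠ z in cofinite, f z = g z := by
  rcases (hf.sub hg).eventually_eq_zero_or_ne_zero with h₀ | h₀
  · exact h₀.mono fun z hz ↦ sub_eq_zero.mp hz
  · obtain ⟨τ, h₁, h₂⟩ := (hfg.and
      ((tendsto_cofinite_of_nonconstant hm hc).eventually h₀)).exists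
    exact (h₂ (sub_eq_zero.mpr h₁)).elim

end Nonconstant

/-! ### The quotient of the Schwarzian by the squared derivative is a modular function -/

/-- The function `-{h, τ} / (2 h'(τ)²)` on the upper half plane. -/
noncomputable def schwarzianQuotient (h : ℍ → ℂ) (τ : ℍ) : ℂ :=
  -schwarzian (h ∘ ofComplex) τ / (2 * deriv (h ∘ ofComplex) τ ^ 2)

theorem schwarzianQuotient_smul {h : ℍ → ℂ} {g : GL (Fin 2) ℝ} (hg : 0 < g.val.det) {τ : ℍ}
    (ha : AnalyticAt ℂ (h ∘ ofComplex) ↑(g • τ)) (hd : deriv (h ∘ ofComplex) ↑(g • τ) ≠ 0) :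
    schwarzianQuotient (fun σ ↦ h (g • σ)) τ = schwarzianQuotient h (g • τ) := by
  obtain ⟨φ, hφ⟩ : ∃ φ : ℂ → ℂ, φ = fun z ↦ ↑(g • ofComplex z) := ⟨_, rfl⟩
  have hφτ : φ τ = ↑(g • τ) := by simp [hφ]
  have hφa : AnalyticAt ℂ φ τ := hφ ▸ τ.analyticAt_smul hg
  have hφd : deriv φ τ ≠ 0 := hφ ▸ τ.deriv_smul_ne_zero hg
  have hφs : schwarzian φ τ = 0 := hφ ▸ schwarzian_smul hg τ
  rw [← hφτ] at ha hd
  rw [schwarzianQuotient, schwarzianQuotient, comp_smul_comp_ofComplex, ← hφ, ← hφτ,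
    schwarzian_comp ha hφa hd hφd, deriv_comp_of_analyticAt ha hφa, hφs]
  field_simp
  ring

theorem deriv_comp_smul_ne_zero {h : ℍ → ℂ} {g : GL (Fin 2) ℝ} (hg : 0 < g.val.det) {τ : ℍ}
    (ha : AnalyticAt ℂ (h ∘ ofComplex) ↑(g • τ)) (hd : deriv (h ∘ ofComplex) ↑(g • τ) ≠ 0) :
    deriv ((fun σ ↦ h (g • σ)) ∘ ofComplex) τ ≠ 0 := by
  obtain ⟨φ, hφ⟩ : ∃ φ : ℂ → ℂ, φ = fun z ↦ ↑(g • ofComplex z) := ⟨_, rfl⟩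
  have hφτ : φ τ = ↑(g • τ) := by simp [hφ]
  rw [← hφτ] at ha hd
  rw [comp_smul_comp_ofComplex, ← hφ,
    deriv_comp_of_analyticAt ha (hφ ▸ τ.analyticAt_smul hg)]
  exact mul_ne_zero hd (hφ ▸ τ.deriv_smul_ne_zero hg)

theorem schwarzianQuotient_congr {h k : ℍ → ℂ} {τ : ℍ} (hhk : h =ᶠ[𝓝 τ] k) :
    schwarzianQuotient h τ = schwarzianQuotient k τ := by
  have := comp_ofComplex_eventuallyEq hhk
  simp only [schwarzianQuotient, schwarzian_congr this, this.deriv_eq]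

theorem MeromorphicAt.schwarzian {f : ℂ → ℂ} {z : ℂ} (hf : MeromorphicAt f z) :
    MeromorphicAt (schwarzian f) z := by
  have hd (n : ℕ) : MeromorphicAt (iteratedDeriv n f) z := by
    rw [iteratedDeriv_eq_iterate]; exact hf.iterated_deriv
  exact .div (.sub (.mul (.mul (.const 2 _) hf.deriv) (hd 3))
    (.mul (.const 3 _) ((hd 2).pow 2))) (.mul (.const 2 _) (hf.deriv.pow 2))

theorem meromorphicAt_schwarzianQuotient {h : ℍ → ℂ} {τ : ℍ}
    (hm : MeromorphicAt (h ∘ ofComplex) τ) :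
    MeromorphicAt (schwarzianQuotient h ∘ ofComplex) τ := by
  have main : MeromorphicAt
      (fun z ↦ -schwarzian (h ∘ ofComplex) z / (2 * deriv (h ∘ ofComplex) z ^ 2)) τ :=
    hm.schwarzian.neg.div (.mul (.const 2 _) (hm.deriv.pow 2))
  refine main.congr ?_
  refine eventually_nhdsWithin_of_eventually_nhds (eventually_nhds_coe_iff.mpr ?_)
  exact .of_forall fun σ ↦ by simp [schwarzianQuotient]

/-- Both `{h, τ}` and `h'(τ)²` have weight `4` under `Γ`, so their quotient is invariant; at a cusp,
both are meromorphic functions of the local parameter `q`, by the chain rule for `τ ↦ q`. -/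
theorem IsModularFunction.schwarzianQuotient {Γ : Subgroup (GL (Fin 2) ℝ)} [Γ.HasDetOne]
    {h : ℍ → ℂ} (hh : IsModularFunction Γ h)
    (hc : ¬ ∃ c : ℂ, ∀ᶠ τ in codiscrete ℍ, h τ = c) :
    IsModularFunction Γ (schwarzianQuotient h) := by
  have ha := eventually_analyticAt_of_meromorphicAt hh.meromorphic
  have hd := eventually_deriv_ne_zero_of_nonconstant hh.meromorphic hc
  refine ⟨fun τ ↦ meromorphicAt_schwarzianQuotient (hh.meromorphic τ), fun γ hγ ↦ ?_,
    fun g hg ↦ ?_⟩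
  · have hdet : 0 < γ.val.det := by
      have : γ.det = 1 := Subgroup.HasDetOne.det_eq hγ
      have := congrArg Units.val this
      simp at this
      simp [this]
    filter_upwards [(tendsto_smul_codiscrete γ).eventually ha,
      (tendsto_smul_codiscrete γ).eventually hd,
      (hh.invariant γ hγ).eventually_nhds_codiscrete] with τ h₁ h₂ h₃
    rw [← schwarzianQuotient_smul hdet h₁ h₂]
    exact schwarzianQuotient_congr h₃
  · obtain ⟨w, hw, F, hF, hcusp⟩ := hh.meromorphic_cusp g hg
    set c : ℂ := 2 * Real.pi * Complex.I / w with hcdef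
    have hc0 : c ≠ 0 := div_ne_zero Complex.two_pi_I_ne_zero (mod_cast hw.ne')
    have hdet : 0 < (g : GL (Fin 2) ℝ).val.det := by simp
    -- With `q = exp (2 π i τ / w)` one has `dq/dτ = c q` and `{q, τ} = -c²/2`.
    refine ⟨w, hw, fun q ↦ -((c * q) ^ 2 * schwarzian F q + -c ^ 2 / 2) /
      (2 * (deriv F q * (c * q)) ^ 2), ?_, ?_⟩
    · have h₀ : MeromorphicAt (fun q ↦ c * q) 0 := .mul (.const c _) (.id _)
      exact (((h₀.pow 2).mul hF.schwarzian).add (.const _ _)).neg.div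
        (.mul (.const 2 _) ((hF.deriv.mul h₀).pow 2))
    · have hq : ∀ᶠ τ : ℍ in atImInfty, AnalyticAt ℂ F (Function.Periodic.qParam w τ) :=
        ((Function.Periodic.qParam_tendsto hw).comp tendsto_coe_atImInfty).eventually
          hF.eventually_analyticAt
      -- The identity `h (g σ) = F (q σ)` holds on an open set, hence may be differentiated.
      have hcusp' : ∀ᶠ τ in atImInfty ⊓ codiscrete ℍ, ∀ᶠ σ in 𝓝 τ,
          h (g • σ) = F (Function.Periodic.qParam w (σ : ℂ)) := by
        obtain ⟨s, hs, t, ht, hst⟩ := eventually_inf.mp hcusp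
        obtain ⟨A, hA⟩ := (atImInfty_mem s).mp hs
        have hA' : ∀ᶠ τ : ℍ in atImInfty, A < τ.im :=
          (atImInfty_mem _).mpr ⟨A + 1, fun τ hτ ↦ (lt_add_one A).trans_le hτ⟩
        filter_upwards [hA'.filter_mono inf_le_left,
          (Filter.Eventually.eventually_nhds_codiscrete (p := (· ∈ t)) ht).filter_mono
            inf_le_right] with τ h₁ h₂
        filter_upwards [continuous_im.continuousAt.eventually (lt_mem_nhds h₁), h₂]
          with σ h₃ h₄ using hst σ ⟨hA σ h₃.le, h₄⟩
      filter_upwards [hcusp', hq.filter_mono inf_le_left,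
        ((tendsto_smul_codiscrete (g : GL (Fin 2) ℝ)).eventually ha).filter_mono inf_le_right,
        ((tendsto_smul_codiscrete (g : GL (Fin 2) ℝ)).eventually hd).filter_mono inf_le_right]
        with τ h₁ h₂ h₃ h₄
      have h₅ := deriv_comp_smul_ne_zero hdet h₃ h₄
      have e := comp_ofComplex_eventuallyEq h₁
      replace e : (fun σ : ℍ ↦ h ((g : GL (Fin 2) ℝ) • σ)) ∘ ofComplex =ᶠ[𝓝 (τ : ℂ)]
          F ∘ Function.Periodic.qParam w := e.trans <| by
        filter_upwards [eventuallyEq_coe_comp_ofComplex τ.im_pos] with z hz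
        simpa using congrArg (fun u ↦ F (Function.Periodic.qParam w u)) hz
      have hqa : AnalyticAt ℂ (Function.Periodic.qParam w) τ :=
        Function.Periodic.differentiable_qParam.analyticAt _
      have hqd : deriv (Function.Periodic.qParam w) τ = c * Function.Periodic.qParam w τ :=
        (qParam_hasDerivAt w τ).deriv
      rw [e.deriv_eq, deriv_comp_of_analyticAt h₂ hqa] at h₅
      change _root_.schwarzianQuotient h ((g : GL (Fin 2) ℝ) • τ) = _
      rw [← schwarzianQuotient_smul hdet h₃ h₄, _root_.schwarzianQuotient, e.deriv_eq,
        schwarzian_congr e, deriv_comp_of_analyticAt h₂ hqa,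
        schwarzian_comp h₂ hqa (left_ne_zero_of_mul h₅) (right_ne_zero_of_mul h₅), hqd,
        schwarzian_qParam hw.ne' τ]

theorem schwarzianBox_eq_zero_iff {Q : RatFunc ℂ} {h : ℍ → ℂ} {τ : ℍ}
    (hd : deriv (h ∘ ofComplex) τ ≠ 0) :
    schwarzianBox Q (h ∘ ofComplex) τ = 0 ↔ Q.value (h τ) = schwarzianQuotient h τ := by
  simp only [schwarzianBox, schwarzianQuotient, Function.comp_apply, ofComplex_apply]
  rw [eq_div_iff (by simpa using hd)]
  constructor <;> intro H
  · linear_combination 2 * H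
  · linear_combination H / 2

theorem IsHauptmodul.existsUnique_isQValue {Γ : Subgroup (GL (Fin 2) ℝ)} [Γ.HasDetOne]
    {h : ℍ → ℂ} (hh : IsHauptmodul Γ h) : ∃! Q : RatFunc ℂ, IsQValue h Q := by
  have hm := hh.isModularFunction.meromorphic
  have hd := eventually_deriv_ne_zero_of_nonconstant hm hh.nonconstant
  obtain ⟨Q, hQ⟩ := hh.generates _ (hh.isModularFunction.schwarzianQuotient hh.nonconstant)
  refine ⟨Q, ?_, fun Q' hQ' ↦ RatFunc.eq_of_eventually_value_eq ?_⟩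
  · filter_upwards [hQ, hd] with τ h₁ h₂
    exact (schwarzianBox_eq_zero_iff h₂).mpr h₁.symm
  · refine (IsCofinitelyRational.value Q').eventually_eq_of_comp_eq
      (.value Q) hm hh.nonconstant ?_
    filter_upwards [hQ, hQ', hd] with τ h₁ h₂ h₃
    rw [← h₁, (schwarzianBox_eq_zero_iff h₃).mp h₂]

/-! ### Schwarzian equations and rational parametrizations -/

/-- If `f = r ∘ t` off a closed discrete set and `f` satisfies the Schwarzian equation of `Q`,
then the Schwarzian expression of `Q` along `r` is the `Q`-value of `t`. -/
theorem eventually_schwarzianBox_eq_value {f t : ℍ → ℂ} {Q Q' r : RatFunc ℂ}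
    (hm : ∀ τ : ℍ, MeromorphicAt (t ∘ ofComplex) τ)
    (hc : ¬ ∃ c : ℂ, ∀ᶠ τ in codiscrete ℍ, t τ = c)
    (hr : ∀ᶠ τ in codiscrete ℍ, f τ = r.value (t τ))
    (hf : ∀ᶠ τ : ℍ in codiscrete ℍ, deriv (f ∘ ofComplex) τ ≠ 0)
    (hQ : IsQValue f Q) (hQ' : IsQValue t Q') :
    ∀ᶠ z in cofinite, schwarzianBox Q r.value z = Q'.value z := by
  refine ((IsCofinitelyRational.value r).schwarzianBox Q).eventually_eq_of_comp_eq
    (.value Q') hm hc ?_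
  filter_upwards [hr.eventually_nhds_codiscrete, hf, hQ, hQ',
    (tendsto_cofinite_of_nonconstant hm hc).eventually r.analyticAt_value,
    eventually_analyticAt_of_meromorphicAt hm,
    eventually_deriv_ne_zero_of_nonconstant hm hc] with τ h₁ h₂ h₃ h₄ h₅ h₆ h₇
  have e : f ∘ ofComplex =ᶠ[𝓝 (τ : ℂ)] r.value ∘ (t ∘ ofComplex) :=
    comp_ofComplex_eventuallyEq (g := fun τ ↦ r.value (t τ)) h₁
  have ht : (t ∘ ofComplex) τ = t τ := by simp
  rw [← ht] at h₅ ⊢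
  have h₈ : deriv r.value ((t ∘ ofComplex) τ) ≠ 0 := by
    rw [e.deriv_eq, deriv_comp_of_analyticAt h₅ h₆] at h₂
    exact left_ne_zero_of_mul h₂
  rw [schwarzianBox_congr Q e, schwarzianBox_comp Q h₅ h₆ h₈ h₇] at h₃
  rw [schwarzianBox] at h₄
  exact mul_left_cancel₀ (pow_ne_zero 2 h₇) (by linear_combination h₃ - h₄)

theorem IsQValue.comp_smul {h : ℍ → ℂ} {Q : RatFunc ℂ}
    (ha : ∀ᶠ τ : ℍ in codiscrete ℍ, AnalyticAt ℂ (h ∘ ofComplex) τ)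
    (hd : ∀ᶠ τ : ℍ in codiscrete ℍ, deriv (h ∘ ofComplex) τ ≠ 0)
    {g : GL (Fin 2) ℝ} (hg : 0 < g.val.det) (hQ : IsQValue h Q) :
    IsQValue (fun τ ↦ h (g • τ)) Q := by
  have hT := tendsto_smul_codiscrete g
  filter_upwards [hT.eventually hQ, hT.eventually ha, hT.eventually hd] with τ h₁ h₂ h₃
  have h₄ := deriv_comp_smul_ne_zero hg h₂ h₃
  rw [schwarzianBox_eq_zero_iff h₄, schwarzianQuotient_smul hg h₂ h₃]
  exact (schwarzianBox_eq_zero_iff h₃).mp h₁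

theorem theorem3p5
    (Γ Γ' : Subgroup (GL (Fin 2) ℝ))
    [Γ.IsArithmetic] [Γ.HasDetOne] [Γ'.IsArithmetic] [Γ'.HasDetOne]
    (h t : ℍ → ℂ) (hh : IsHauptmodul Γ h) (ht : IsHauptmodul Γ' t)
    (n : ℕ) (hn : 0 < n) (h₁ h₂ : RatFunc ℂ)
    (hh₁ : ∀ᶠ τ : ℍ in codiscrete ℍ, h τ = h₁.value (t τ))
    (hh₂ : ∀ᶠ τ : ℍ in codiscrete ℍ, h (ofComplex ((n : ℂ) * (τ : ℂ))) = h₂.value (t τ)) :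
    (∃! Q : RatFunc ℂ, IsQValue h Q) ∧ (∃! Q' : RatFunc ℂ, IsQValue t Q') ∧
      ∀ Q Q' : RatFunc ℂ, IsQValue h Q → IsQValue t Q' →
        ∀ᶠ z : ℂ in cofinite,
          schwarzianBox Q h₁.value z = schwarzianBox Q h₂.value z ∧
            schwarzianBox Q h₂.value z = Q'.value z := by
  refine ⟨hh.existsUnique_isQValue, ht.existsUnique_isQValue, fun Q Q' hQ hQ' ↦ ?_⟩
  have hm := hh.isModularFunction.meromorphic
  have ha := eventually_analyticAt_of_meromorphicAt hm
  have hd := eventually_deriv_ne_zero_of_nonconstant hm hh.nonconstant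
  have htm := ht.isModularFunction.meromorphic
  -- Multiplication by `n` on `ℍ` is the action of the matrix `diag (n, 1)`.
  obtain ⟨g, hg, hgn⟩ : ∃ g : GL (Fin 2) ℝ, 0 < g.val.det ∧
      ∀ τ : ℍ, ofComplex ((n : ℂ) * (τ : ℂ)) = g • τ := by
    have hn' : (0 : ℝ) < n := by exact_mod_cast hn
    have hdet : (!![(n : ℝ), 0; 0, 1]).det = n := by simp
    have hpos : 0 < (Matrix.GeneralLinearGroup.mkOfDetNeZero !![(n : ℝ), 0; 0, 1]
        (hdet.trans_ne hn'.ne')).det.val := hn'.trans_eq hdet.symm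
    refine ⟨_, hpos, fun τ ↦ ?_⟩
    rw [eq_comm, ← ofComplex_apply (_ • τ), coe_smul_of_det_pos hpos]
    simp [num, denom, Matrix.GeneralLinearGroup.mkOfDetNeZero]
  simp only [hgn] at hh₂
  have key₁ := eventually_schwarzianBox_eq_value htm ht.nonconstant hh₁ hd hQ hQ'
  have hT := tendsto_smul_codiscrete g
  have hd' : ∀ᶠ τ : ℍ in codiscrete ℍ, deriv ((fun σ ↦ h (g • σ)) ∘ ofComplex) τ ≠ 0 := by
    filter_upwards [hT.eventually ha, hT.eventually hd] with τ h₃ h₄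
      using deriv_comp_smul_ne_zero hg h₃ h₄
  have key₂ := eventually_schwarzianBox_eq_value htm ht.nonconstant hh₂ hd'
    (hQ.comp_smul ha hd hg) hQ'
  filter_upwards [key₁, key₂] with z h₃ h₄ using ⟨h₃.trans h₄.symm, h₄⟩
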